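/- Let $V$ be a finite nonempty set, $n=|V|$, and let $f:2^V\to\mathbf Z$ be submodular, i.e. $f(X)+f(Y)\ge f(X\cup Y)+f(X\cap Y)$ for all $X,Y\subseteq V$, with $f(\emptyset)=0$. Let $M\in\mathbf R$ satisfy $|f(X)|\le M$ for all $X\subseteq V$. Write $x(X)=\sum_{v\in X}x(v)$ and let $\mathrm B(f)=\{x\in\mathbf R^V: x(V)=f(V),\ x(X)\le f(X)\ \forall X\subseteq V\}$. For $y\in\mathrm B(f)$ and distinct $u,v\in V$ let $\tilde c(y,u,v)=\max\{\alpha\in\mathbf R: y+\alpha(\chi_u-\chi_v)\in \mathrm B(f)\}$. For a linear ordering $L$ of $V$ let $L(v)$ be the set of vertices up to and including $v$; the extreme base generated by $L$ is $y(v)=f(L(v))-f(L(v)\setminus\{v\})$. Consider the following algorithm $\mathsf{SFM}$. It maintains $\delta\in\mathbf R$, a flow $\varphi:V\times V\to\mathbf R$, a vector $x\in\mathbf R^V$, a finite index set $I$ and, for each $i\in I$, a linear ordering $L_i$, a vector $y_i\in\mathbf R^V$ and a coefficient $\lambda_i$. At every moment, with $\partial\varphi(v)=\sum_{u\in V}\varphi(u,v)$,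 let $S=\{v: x(v)\le\partial\varphi(v)-\delta\}$ and $T=\{v: x(v)\ge\partial\varphi(v)+\delta\}$; let $G(\varphi)$ be the directed graph on $V$ with arcs $(u,v)$, $u\ne v$, $\varphi(u,v)\le 0$; let $W$ be the set of vertices reachable from $S$ in $G(\varphi)$; and let $Z$ be the set of active pairs, i.e. pairs $(i,v)$ with $i\in I$ such that $v$ is the last vertex in $L_i$ among the vertices of $V\setminus W$ that satisfy $W\setminus L_i(v)\ne\emptyset$. *Initialization:* choose any linear ordering $L$ and any index $i$; put $I=\{i\}$, $L_i=L$, $\lambda_i=1$, $x=y_i=$ the extreme base generated by $L$, $\varphi=0$, $\delta=M$. *Scaling loop:* while $\delta\ge 1/n^2$, perform a scaling phase: replace $\delta$ by $\delta/2$, replace each $\varphi(u,v)$ by the nearest value in $[-\delta,\delta]$, and then, while $S\neq\emptyset$, $T\ne\emptyset$ and ($W\cap T\neq\emptyset$ or $Z\ne\emptyset$), do (a)–(c): (a) While $W\cap T=\emptyset$ and $Z\ne\emptyset$, choose any $(i,v)\in Z$, let $u$ be the immediate successor of $v$ in $L_i$, and apply $\mathsf{Push}(i,u,v)$: put $c=\tilde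 c(y_i,u,v)$ and $\alpha=\min\{\delta,\lambda_ic\}$; decrease $\varphi(u,v)$ by $\alpha$ and increase $\varphi(v,u)$ by $\alpha$; if $\alpha<\lambda_i c$, add to $I$ a new index $k$ with $y_k=y_i$, $L_k=L_i$, $\lambda_k=\lambda_i-\alpha/c$, and set $\lambda_i=\alpha/c$; in either case replace $y_i$ by $y_i+c(\chi_u-\chi_v)$, interchange $u$ and $v$ in $L_i$, and set $x=\sum_{i\in I}\lambda_iy_i$. (b) If $W\cap T\ne\emptyset$, choose any directed path with distinct vertices from $S$ to $T$ in $G(\varphi)$ and, for each of its arcs $(u,v)$, increase $\varphi(u,v)$ by $\delta$ and decrease $\varphi(v,u)$ by $\delta$. (c) Replace $I$ by a subset, and the $\lambda_i$ by positive coefficients with sum $1$, such that the $y_i$, $i\in I$, are affinely independent and $x=\sum_{i\in I}\lambda_iy_i$ for the unchanged $x$ (any such choice is allowed). *Output:* when $\delta<1/n^2$ at the test of the scaling loop, stop and return $X=\emptyset$ if $S=\emptyset$; otherwise $X=V$ if $T=\emptyset$; otherwise $X=W$. **Theorem.** However the free choices are made, the algorithm never gets stuck and terminates after finitely many steps, that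 is, at the end of a $\delta$-scaling phase with $\delta<1/n^2$ (or immediately, if $M<1/n^2$), and the set $X$ that it returns is a minimizer of $f$: $f(X)\le f(Y)$ for all $Y\subseteq V$. -/

import Mathlib

open Finset

namespace SFM

variable {V : Type*} [Fintype V] [DecidableEq V]

/-- Submodularity of an integer-valued set function on the subsets of `V`. -/
def Submodular (f : Finset V → ℤ) : Prop :=
  ∀ X Y : Finset V, f (X ∪ Y) + f (X ∩ Y) ≤ f X + f Y

/-- The base polyhedron `B(f)`. -/
def basePolyhedron (f : Finset V → ℤ) : Set (V → ℝ) :=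
  {x | ∑ v, x v = (f univ : ℝ) ∧ ∀ X : Finset V, ∑ v ∈ X, x v ≤ (f X : ℝ)}

/-- `c` is the exchange capacity of the pair `(u, v)` at `y`, that is, the maximum of all `α` with
`y + α (χ_u - χ_v) ∈ B(f)`. -/
def IsExchangeCapacity (f : Finset V → ℤ) (y : V → ℝ) (u v : V) (c : ℝ) : Prop :=
  IsGreatest {α : ℝ | y + α • (Pi.single u 1 - Pi.single v 1) ∈ basePolyhedron f} c

/-- A linear ordering of `V`; `L v` is the (zero-based) position of the vertex `v`. -/
abbrev Ordering (V : Type*) [Fintype V] : Type _ := V ≃ Fin (Fintype.card V)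

/-- The initial segment `L(v)`: the vertices up to and including `v`. -/
def Ordering.upTo (L : Ordering V) (v : V) : Finset V := univ.filter fun w => L w ≤ L v

/-- The extreme base generated by `L` through the greedy algorithm. -/
def greedyBase (f : Finset V → ℤ) (L : Ordering V) : V → ℝ := fun v =>
  (f (Ordering.upTo L v) : ℝ) - (f ((Ordering.upTo L v).erase v) : ℝ)

/-- `v` is active for `L` and `W`: it is the last vertex in `L` among the vertices of `V \ W` that
satisfy `W \ L(v) ≠ ∅`. -/
def IsActive (L : Ordering V) (W : Finset V) (v : V) : Prop :=
  v ∉ W ∧ (W \ Ordering.upTo L v).Nonempty ∧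
    ∀ w, w ∉ W → (W \ Ordering.upTo L w).Nonempty → L w ≤ L v

/-- The boundary `∂φ` of a flow. -/
def boundary (φ : V → V → ℝ) (v : V) : ℝ := ∑ u, φ u v

/-- The arcs of the residual graph `G(φ)`. -/
def Residual (φ : V → V → ℝ) (u v : V) : Prop := u ≠ v ∧ φ u v ≤ 0

/-- Control points of the algorithm. -/
inductive Stage
  /-- about to test the guard `δ ≥ 1/n²` of the scaling loop -/
  | scaling
  /-- inside a scaling phase, about to test the guard of the phase loop -/
  | phase
  /-- about to test the guard of the loop that performs pushes -/
  | pushing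
  /-- about to re-express `x` by affinely independent extreme bases -/
  | reducing
  /-- the algorithm has terminated -/
  | done

/-- The values of the program variables. Only the values of `L`, `y` and `lam` at indices in `I`
are meaningful. The sets `S`, `T`, `W`, `Z` are kept up to date throughout, hence they are functions
of the other variables, see below. -/
structure State (V : Type*) [Fintype V] where
  stage : Stage
  δ : ℝ
  φ : V → V → ℝ
  x : V → ℝ
  I : Finset ℕ
  L : ℕ → Ordering V
  y : ℕ → V → ℝ
  lam : ℕ → ℝ

namespace State

/-- `S = {v | x(v) ≤ ∂φ(v) - δ}`. -/
noncomputable def S (s : State V) : Finset V :=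
  univ.filter fun v => s.x v ≤ boundary s.φ v - s.δ

/-- `T = {v | x(v) ≥ ∂φ(v) + δ}`. -/
noncomputable def T (s : State V) : Finset V :=
  univ.filter fun v => boundary s.φ v + s.δ ≤ s.x v

open Classical in
/-- The set of vertices reachable from `S` in `G(φ)`. -/
noncomputable def W (s : State V) : Finset V :=
  univ.filter fun v => ∃ a ∈ s.S, Relation.ReflTransGen (Residual s.φ) a v

/-- The set of active pairs. -/
def Z (s : State V) : Set (ℕ × V) :=
  {p | p.1 ∈ s.I ∧ IsActive (s.L p.1) s.W p.2}

open Classical in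
/-- The set `X` that the algorithm returns. -/
noncomputable def output (s : State V) : Finset V :=
  if s.S = ∅ then ∅ else if s.T = ∅ then univ else s.W

end State

/-- The state after initialization with the linear ordering `L`, stored at the index `i`. -/
noncomputable def initial (f : Finset V → ℤ) (M : ℝ) (L : Ordering V) (i : ℕ) : State V where
  stage := .scaling
  δ := M
  φ := fun _ _ => 0
  x := greedyBase f L
  I := {i}
  L := fun _ => L
  y := fun _ => greedyBase f L
  lam := fun _ => 1

/-- Beginning of a scaling phase: `δ` is halved, and every `φ(u, v)` is replaced by the nearest
value in `[-δ, δ]`. -/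
noncomputable def beginPhase (s : State V) : State V :=
  { s with
    stage := .phase
    δ := s.δ / 2
    φ := fun u v => max (-(s.δ / 2)) (min (s.δ / 2) (s.φ u v)) }

/-- The flow obtained from `φ` by sending `α` units through the arc `(u, v)`. -/
def sendArc (φ : V → V → ℝ) (u v : V) (α : ℝ) : V → V → ℝ := fun a b =>
  φ a b + (if a = u ∧ b = v then α else 0) - (if a = v ∧ b = u then α else 0)

open Classical in
/-- The operation `Push(i, u, v)`, where `c` is the exchange capacity of `(u, v)` at `y_i` and `k`
is the new index, used only if the push is nonsaturating. -/
noncomputable def push (s : State V) (i : ℕ) (u v : V) (c : ℝ) (k : ℕ) : State V :=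
  let α : ℝ := min s.δ (s.lam i * c)
  let nonsaturating : Prop := α < s.lam i * c
  let I' := if nonsaturating then insert k s.I else s.I
  let lam' := if nonsaturating then
      Function.update (Function.update s.lam k (s.lam i - α / c)) i (α / c) else s.lam
  let y' := Function.update (if nonsaturating then Function.update s.y k (s.y i) else s.y)
    i (s.y i + c • (Pi.single u 1 - Pi.single v 1))
  let L' := Function.update (if nonsaturating then Function.update s.L k (s.L i) else s.L)
    i ((Equiv.swap u v).trans (s.L i))
  { stage := s.stage
    δ := s.δ
    φ := sendArc s.φ u v (-α)
    x := ∑ j ∈ I', lam' j • y' j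
    I := I'
    L := L'
    y := y'
    lam := lam' }

/-- `P`, given by its sequence of vertices, is a directed path from a vertex of `S` to a vertex of
`T` in the residual graph. -/
def IsAugmentingPath (s : State V) (P : List V) : Prop :=
  P.Nodup ∧ P.IsChain (Residual s.φ) ∧ (∃ a ∈ s.S, P.head? = some a) ∧
    ∃ b ∈ s.T, P.getLast? = some b

/-- Send `δ` units of flow through every arc of `P`. -/
noncomputable def augment (s : State V) (P : List V) : State V :=
  { s with
    stage := .reducing
    φ := fun a b => s.φ a b + (if (a, b) ∈ P.zip P.tail then s.δ else 0)
      - (if (b, a) ∈ P.zip P.tail then s.δ else 0) }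

/-- The guard of the phase loop: neither `S` nor `T` is empty, and there is an augmenting path or an
active pair. -/
def PhaseGuard (s : State V) : Prop :=
  s.S.Nonempty ∧ s.T.Nonempty ∧ ((s.W ∩ s.T).Nonempty ∨ s.Z.Nonempty)

/-- One step of the algorithm. All choices that the algorithm leaves open (active pair, new index,
augmenting path, new expression for `x`) are nondeterministic. -/
inductive Step (f : Finset V → ℤ) : State V → State V → Prop
  | beginPhase (s : State V) (hs : s.stage = .scaling)
      (hδ : 1 / (Fintype.card V : ℝ) ^ 2 ≤ s.δ) :
      Step f s (beginPhase s)
  | halt (s : State V) (hs : s.stage = .scaling)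
      (hδ : s.δ < 1 / (Fintype.card V : ℝ) ^ 2) :
      Step f s { s with stage := .done }
  | enter (s : State V) (hs : s.stage = .phase) (hg : PhaseGuard s) :
      Step f s { s with stage := .pushing }
  | endPhase (s : State V) (hs : s.stage = .phase) (hg : ¬ PhaseGuard s) :
      Step f s { s with stage := .scaling }
  | push (s : State V) (hs : s.stage = .pushing) (hW : s.W ∩ s.T = ∅)
      (i : ℕ) (u v : V) (hZ : (i, v) ∈ s.Z) (hu : (s.L i u : ℕ) = (s.L i v : ℕ) + 1)
      (c : ℝ) (hc : IsExchangeCapacity f (s.y i) u v c) (k : ℕ) (hk : k ∉ s.I) :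
      Step f s (push s i u v c k)
  | augment (s : State V) (hs : s.stage = .pushing) (hW : (s.W ∩ s.T).Nonempty)
      (P : List V) (hP : IsAugmentingPath s P) :
      Step f s (augment s P)
  | noPath (s : State V) (hs : s.stage = .pushing) (hW : s.W ∩ s.T = ∅) (hZ : s.Z = ∅) :
      Step f s { s with stage := .reducing }
  | reduce (s : State V) (hs : s.stage = .reducing) (J : Finset ℕ) (hJ : J ⊆ s.I) (mu : ℕ → ℝ)
      (hpos : ∀ j ∈ J, 0 < mu j) (hsum : ∑ j ∈ J, mu j = 1)
      (hx : s.x = ∑ j ∈ J, mu j • s.y j)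
      (hind : AffineIndependent ℝ (fun j : J => s.y j)) :
      Step f s { s with stage := .phase, I := J, lam := mu }

end SFM

namespace SFM

variable {V : Type*} [Fintype V] [DecidableEq V]

/-! Correctness is weak duality plus integrality. The vector x stays a convex combination of greedy
bases, so x(Y) ≤ f(Y) for all Y. If x(X) = f(X), x ≤ ε on X, x ≥ -ε off X and nε < 1, then f(X) <
f(Y) + 1, so X is a minimizer (`isMin_of_tight`). When a phase ends with S and T nonempty, W misses
T and no pair is active; then W is an initial segment of every L_i and hence tight, and |φ| ≤ δ
allows ε = nδ. If S or T is empty, ∅ or V serves in the same way.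

Termination: a push shifts x and ∂φ by the same vector, so the excess x - ∂φ, S and T persist. W
never shrinks; a nonsaturating push adds v to W, and a push that keeps W moves a vertex of W forward
in its ordering. An augmentation lowers the total absolute excess by at least δ, and a new phase
halves δ. `Step.rank_lt` combines these lexicographically.

Progress: consecutive vertices have an explicit exchange capacity (`isExchangeCapacity_greedyBase`),
residual walks shorten to paths, and Carathéodory's theorem supplies the reduction. -/

/-! ### Greedy bases. -/

omit [DecidableEq V] in
theorem Ordering.mem_upTo {L : Ordering V} {v w : V} : w ∈ L.upTo v ↔ L w ≤ L v := by
  simp [Ordering.upTo]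

/-- Remove the last vertex v of X and apply submodularity to X and L(v) \ {v}: their union is L(v),
their intersection X \ {v}. -/
theorem greedyBase_sum_le {f : Finset V → ℤ} (hf : Submodular f) (hf0 : f ∅ = 0)
    (L : Ordering V) (X : Finset V) : ∑ v ∈ X, greedyBase f L v ≤ (f X : ℝ) := by
  induction X using Finset.strongInduction with
  | H X ih =>
    rcases X.eq_empty_or_nonempty with rfl | hX
    · simp [hf0]
    · obtain ⟨v, hv, hmax⟩ := X.exists_max_image L hX
      have h1 := ih (X.erase v) (Finset.erase_ssubset hv)
      have h2 := hf X ((L.upTo v).erase v)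
      have h3 : X ∪ (L.upTo v).erase v = L.upTo v := by
        ext w
        simp only [mem_union, mem_erase, Ordering.mem_upTo]
        constructor
        · rintro (h | h)
          exacts [hmax w h, h.2]
        · intro h
          by_cases hw : w = v
          · exact Or.inl (hw ▸ hv)
          · exact Or.inr ⟨hw, h⟩
      have h4 : X ∩ (L.upTo v).erase v = X.erase v := by
        ext w
        simp only [mem_inter, mem_erase, Ordering.mem_upTo]
        exact ⟨fun h => ⟨h.2.1, h.1⟩, fun h => ⟨h.2, h.1, hmax w h.2⟩⟩
      rw [h3, h4] at h2
      have h5 : (f (L.upTo v) : ℝ) + f (X.erase v) ≤ f X + f ((L.upTo v).erase v) := by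
        exact_mod_cast h2
      rw [← Finset.add_sum_erase X _ hv]
      have h6 : greedyBase f L v = (f (L.upTo v) : ℝ) - f ((L.upTo v).erase v) := rfl
      linarith

/-- The greedy base is tight on the initial segments of the ordering. -/
theorem greedyBase_sum_eq {f : Finset V → ℤ} (hf0 : f ∅ = 0)
    (L : Ordering V) (X : Finset V) (hX : ∀ v ∈ X, ∀ w, L w ≤ L v → w ∈ X) :
    ∑ v ∈ X, greedyBase f L v = (f X : ℝ) := by
  induction X using Finset.strongInduction with
  | H X ih =>
    rcases X.eq_empty_or_nonempty with rfl | hne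
    · simp [hf0]
    · obtain ⟨v, hv, hmax⟩ := X.exists_max_image L hne
      have hXv : X = L.upTo v := by
        ext w
        rw [Ordering.mem_upTo]
        exact ⟨hmax w, hX v hv w⟩
      have h1 := ih (X.erase v) (Finset.erase_ssubset hv) (fun a ha w hw => by
        rw [mem_erase] at ha ⊢
        refine ⟨?_, hX a ha.2 w hw⟩
        rintro rfl
        exact ha.1 (L.injective (le_antisymm (hmax a ha.2) hw)))
      rw [← Finset.add_sum_erase X _ hv, h1]
      have h6 : greedyBase f L v = (f (L.upTo v) : ℝ) - f ((L.upTo v).erase v) := rfl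
      rw [h6, ← hXv]
      ring

theorem greedyBase_mem {f : Finset V → ℤ} (hf : Submodular f) (hf0 : f ∅ = 0)
    (L : Ordering V) : greedyBase f L ∈ basePolyhedron f :=
  ⟨greedyBase_sum_eq hf0 L univ fun _ _ _ _ => mem_univ _, greedyBase_sum_le hf hf0 L⟩

omit [Fintype V] in
theorem sum_add_smul_single_sub_single (y : V → ℝ) (u v : V) (c : ℝ) (X : Finset V) :
    ∑ w ∈ X, (y + c • (Pi.single u 1 - Pi.single v 1 : V → ℝ)) w =
      ∑ w ∈ X, y w + c * ((if u ∈ X then 1 else 0) - (if v ∈ X then 1 else 0)) := by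
  simp [Finset.sum_add_distrib, ← Finset.mul_sum, Finset.sum_sub_distrib, Pi.single_apply]

/-! ### Interchanging consecutive vertices. -/

section Swap

variable {L : Ordering V} {u v : V}

theorem Ordering.swap_upTo_of_ne (hu : (L u : ℕ) = (L v : ℕ) + 1) {w : V} (hwu : w ≠ u)
    (hwv : w ≠ v) : Ordering.upTo ((Equiv.swap u v).trans L) w = L.upTo w := by
  have h1 : (L w : ℕ) ≠ L u := fun h => hwu (L.injective (Fin.ext h))
  have h2 : (L w : ℕ) ≠ L v := fun h => hwv (L.injective (Fin.ext h))
  ext a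
  simp only [Ordering.mem_upTo, Equiv.trans_apply, Equiv.swap_apply_of_ne_of_ne hwu hwv,
    Equiv.swap_apply_def, Fin.le_def]
  split_ifs with ha hb
  · subst ha; omega
  · subst hb; omega
  · rfl

theorem Ordering.swap_upTo_right (hu : (L u : ℕ) = (L v : ℕ) + 1) :
    Ordering.upTo ((Equiv.swap u v).trans L) v = L.upTo u := by
  ext a
  simp only [Ordering.mem_upTo, Equiv.trans_apply, Equiv.swap_apply_right,
    Equiv.swap_apply_def, Fin.le_def]
  split_ifs with ha hb
  · subst ha; omega
  · subst hb; omega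
  · rfl

theorem Ordering.swap_upTo_left (hu : (L u : ℕ) = (L v : ℕ) + 1) :
    Ordering.upTo ((Equiv.swap u v).trans L) u = (L.upTo u).erase v := by
  ext a
  simp only [mem_erase, Ordering.mem_upTo, Equiv.trans_apply, Equiv.swap_apply_left,
    Equiv.swap_apply_def, Fin.le_def]
  split_ifs with ha hb
  · subst ha
    have : a ≠ v := by rintro rfl; omega
    simp [this]
  · subst hb; simp; omega
  · have h1 : (L a : ℕ) ≠ L u := fun h => ha (L.injective (Fin.ext h))
    constructor
    · intro h; exact ⟨hb, by omega⟩
    · intro h; omega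

theorem Ordering.upTo_erase_succ (hu : (L u : ℕ) = (L v : ℕ) + 1) :
    (L.upTo u).erase u = L.upTo v := by
  ext a
  simp only [mem_erase, Ordering.mem_upTo, Fin.le_def]
  constructor
  · rintro ⟨h1, h2⟩
    have : (L a : ℕ) ≠ L u := fun h => h1 (L.injective (Fin.ext h))
    omega
  · intro h
    refine ⟨?_, by omega⟩
    rintro rfl; omega

/-- Interchanging two consecutive vertices moves the greedy base along `χ_u - χ_v`. -/
theorem greedyBase_swap (f : Finset V → ℤ) (hu : (L u : ℕ) = (L v : ℕ) + 1) :
    greedyBase f ((Equiv.swap u v).trans L) = greedyBase f L +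
      (((f ((L.upTo u).erase v) : ℝ) - f ((L.upTo v).erase v)) - greedyBase f L u) •
        (Pi.single u 1 - Pi.single v 1 : V → ℝ) := by
  have huv : u ≠ v := by rintro rfl; omega
  have h1 := Ordering.upTo_erase_succ hu
  have h2 : ((L.upTo u).erase v).erase u = (L.upTo v).erase v := by
    rw [Finset.erase_right_comm, h1]
  funext w
  by_cases hwu : w = u
  · subst hwu
    simp only [greedyBase, Ordering.swap_upTo_left hu, h1, h2, Pi.add_apply, Pi.smul_apply,
      Pi.sub_apply, Pi.single_eq_same, Pi.single_eq_of_ne huv, smul_eq_mul]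
    ring
  by_cases hwv : w = v
  · subst hwv
    simp only [greedyBase, Ordering.swap_upTo_right hu, h1, Pi.add_apply, Pi.smul_apply,
      Pi.sub_apply, Pi.single_eq_same, Pi.single_eq_of_ne huv.symm, smul_eq_mul]
    ring
  · simp [greedyBase, Ordering.swap_upTo_of_ne hu hwu hwv, Pi.single_eq_of_ne hwu,
      Pi.single_eq_of_ne hwv]

/-- The value is attained at the greedy base of the interchanged ordering. It cannot be exceeded
because the constraint of L(u) \ {v}, which contains u but not v, becomes tight there. -/
theorem isExchangeCapacity_greedyBase {f : Finset V → ℤ} (hf : Submodular f) (hf0 : f ∅ = 0)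
    (hu : (L u : ℕ) = (L v : ℕ) + 1) :
    IsExchangeCapacity f (greedyBase f L) u v
      (((f ((L.upTo u).erase v) : ℝ) - f ((L.upTo v).erase v)) - greedyBase f L u) := by
  have huv : u ≠ v := by rintro rfl; omega
  constructor
  · rw [Set.mem_ofPred_eq, ← greedyBase_swap f hu]
    exact greedyBase_mem hf hf0 _
  · intro α hα
    have h1 := hα.2 ((L.upTo u).erase v)
    rw [sum_add_smul_single_sub_single] at h1
    have hmem : u ∈ (L.upTo u).erase v := mem_erase.2 ⟨huv, Ordering.mem_upTo.2 le_rfl⟩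
    rw [if_pos hmem, if_neg (by simp), ← Finset.add_sum_erase _ _ hmem,
      Finset.erase_right_comm, Ordering.upTo_erase_succ hu,
      greedyBase_sum_eq hf0 L ((L.upTo v).erase v)] at h1
    · linarith
    · intro a ha w hw
      rw [mem_erase, Ordering.mem_upTo] at ha ⊢
      refine ⟨?_, hw.trans ha.2⟩
      rintro rfl
      exact ha.1 (L.injective (le_antisymm ha.2 hw))

theorem IsExchangeCapacity.greedyBase_add {f : Finset V → ℤ} (hf : Submodular f) (hf0 : f ∅ = 0)
    (hu : (L u : ℕ) = (L v : ℕ) + 1) {c : ℝ}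
    (hc : IsExchangeCapacity f (greedyBase f L) u v c) :
    greedyBase f L + c • (Pi.single u 1 - Pi.single v 1 : V → ℝ) =
      greedyBase f ((Equiv.swap u v).trans L) := by
  rw [greedyBase_swap f hu, hc.unique (isExchangeCapacity_greedyBase hf hf0 hu)]

theorem IsExchangeCapacity.nonneg {f : Finset V → ℤ} {y : V → ℝ} (hy : y ∈ basePolyhedron f)
    {c : ℝ} (hc : IsExchangeCapacity f y u v c) : 0 ≤ c :=
  hc.2 (by simpa using hy)

end Swap

/-! ### Optimality certificate, paths, Carathéodory. -/

/-- A minimizer certificate: a base that is tight on `X`, almost nonpositive on `X` and almost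
nonnegative elsewhere. -/
theorem isMin_of_tight {f : Finset V → ℤ} {x : V → ℝ} (hx : ∀ Y, ∑ v ∈ Y, x v ≤ (f Y : ℝ))
    {X : Finset V} (hX : ∑ v ∈ X, x v = (f X : ℝ)) {ε : ℝ} (hε : 0 ≤ ε)
    (hn : Fintype.card V * ε < 1)
    (hin : ∀ v ∈ X, x v ≤ ε) (hout : ∀ v, v ∉ X → -ε ≤ x v) (Y : Finset V) : f X ≤ f Y := by
  have h1 := hx Y
  have h2 : ∑ v ∈ X, x v - ∑ v ∈ Y, x v ≤ Fintype.card V * ε := by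
    have e1 : ∑ v ∈ X, x v = ∑ v, if v ∈ X then x v else 0 := by simp
    have e2 : ∑ v ∈ Y, x v = ∑ v, if v ∈ Y then x v else 0 := by simp
    rw [e1, e2, ← Finset.sum_sub_distrib, ← nsmul_eq_mul, ← Finset.card_univ]
    refine Finset.sum_le_card_nsmul _ _ _ fun v _ => ?_
    have a1 := hin v
    have a2 := hout v
    split_ifs with p q q
    · simpa using hε
    · simpa using a1 p
    · have := a2 p; linarith
    · simpa using hε
  have h3 : (f X : ℝ) < f Y + 1 := by linarith
  have h4 : f X < f Y + 1 := by exact_mod_cast h3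
  omega

theorem exists_nodup_isChain_of_reflTransGen {α : Type*} {R : α → α → Prop} {a b : α}
    (h : Relation.ReflTransGen R a b) :
    ∃ P : List α, P.Nodup ∧ P.IsChain R ∧ P.head? = some a ∧ P.getLast? = some b := by
  classical
  induction h using Relation.ReflTransGen.head_induction_on with
  | refl => exact ⟨[b], by simp, by simp, rfl, rfl⟩
  | @head a c hac _ ih =>
    obtain ⟨P, hnd, hch, hh, hl⟩ := ih
    by_cases ha : a ∈ P
    -- The path already visits a: cut off the closed walk by restarting there.
    · obtain ⟨s, t, rfl⟩ := List.append_of_mem ha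
      refine ⟨a :: t, hnd.of_append_right, hch.right_of_append, rfl, ?_⟩
      rwa [List.getLast?_append_of_ne_nil _ (by simp)] at hl
    · cases P with
      | nil => simp at hh
      | cons d P =>
        simp only [List.head?_cons, Option.some.injEq] at hh
        subst hh
        refine ⟨a :: d :: P, hnd.cons ha, ?_, rfl, ?_⟩
        · exact List.isChain_cons_cons.2 ⟨hac, hch⟩
        · simpa [List.getLast?_cons_cons] using hl

theorem rel_of_mem_zip_tail {α : Type*} {R : α → α → Prop} {P : List α} (h : P.IsChain R)
    {a b : α} (hab : (a, b) ∈ P.zip P.tail) : R a b := by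
  induction P with
  | nil => simp at hab
  | cons c P ih =>
    cases P with
    | nil => simp at hab
    | cons d P =>
      rw [List.isChain_cons_cons] at h
      simp only [List.tail_cons, List.zip_cons_cons, List.mem_cons, Prod.mk.injEq] at hab
      rcases hab with ⟨rfl, rfl⟩ | hab
      · exact h.1
      · exact ih h.2 hab

/-- The flow along a path with distinct vertices has excess only at the ends of the path. -/
theorem sum_zip_tail_sub (P : List V) (hP : P.Nodup) (v : V) :
    ∑ u, ((if (u, v) ∈ P.zip P.tail then (1 : ℝ) else 0) -
        (if (v, u) ∈ P.zip P.tail then 1 else 0)) =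
      (if P.getLast? = some v then 1 else 0) - (if P.head? = some v then 1 else 0) := by
  induction P with
  | nil => simp
  | cons a P ih =>
    cases P with
    | nil => simp
    | cons b P =>
      have ih := ih hP.of_cons
      have hab : ∀ x y : V, (if (x, y) ∈ (a :: b :: P).zip (a :: b :: P).tail then (1 : ℝ) else 0) =
          (if x = a ∧ y = b then 1 else 0) +
            (if (x, y) ∈ (b :: P).zip (b :: P).tail then 1 else 0) := by
        intro x y
        have h0 : (x, y) ∈ (a :: b :: P).zip (a :: b :: P).tail ↔
            (x = a ∧ y = b) ∨ (x, y) ∈ (b :: P).zip (b :: P).tail := by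
          simp only [List.tail_cons, List.zip_cons_cons, List.mem_cons, Prod.mk.injEq]
        by_cases h1 : x = a ∧ y = b
        · have h2 : (x, y) ∉ (b :: P).zip (b :: P).tail := fun h =>
            (List.nodup_cons.1 hP).1 (h1.1 ▸ (List.of_mem_zip h).1)
          rw [if_pos (h0.2 (Or.inl h1)), if_pos h1, if_neg h2, add_zero]
        · rw [if_neg h1, zero_add]
          exact if_congr (h0.trans (or_iff_right h1)) rfl rfl
      simp only [hab]
      have e : ∀ u, ((if u = a ∧ v = b then (1 : ℝ) else 0) +
            (if (u, v) ∈ (b :: P).zip (b :: P).tail then 1 else 0) -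
          ((if v = a ∧ u = b then 1 else 0) +
            (if (v, u) ∈ (b :: P).zip (b :: P).tail then 1 else 0))) =
          ((if u = a ∧ v = b then (1 : ℝ) else 0) - (if v = a ∧ u = b then 1 else 0)) +
          ((if (u, v) ∈ (b :: P).zip (b :: P).tail then 1 else 0) -
            (if (v, u) ∈ (b :: P).zip (b :: P).tail then 1 else 0)) := fun u => by ring
      simp only [e]
      rw [Finset.sum_add_distrib, ih, Finset.sum_sub_distrib]
      have e1 : ∑ u : V, (if u = a ∧ v = b then (1 : ℝ) else 0) = if b = v then 1 else 0 := by
        by_cases h : v = b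
        · simp [h]
        · simp [h, Ne.symm h]
      have e2 : ∑ u : V, (if v = a ∧ u = b then (1 : ℝ) else 0) = if a = v then 1 else 0 := by
        by_cases h : v = a
        · simp [h]
        · simp [h, Ne.symm h]
      rw [e1, e2]
      simp only [List.getLast?_cons_cons, List.head?_cons, Option.some.injEq]
      ring

/-- Carathéodory's theorem for an indexed convex combination. -/
theorem exists_affineIndependent_subset {E : Type*} [AddCommGroup E] [Module ℝ E]
    (I : Finset ℕ) (y : ℕ → E) (lam : ℕ → ℝ) (hpos : ∀ j ∈ I, 0 < lam j)
    (hsum : ∑ j ∈ I, lam j = 1) :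
    ∃ J ⊆ I, ∃ mu : ℕ → ℝ, (∀ j ∈ J, 0 < mu j) ∧ ∑ j ∈ J, mu j = 1 ∧
      ∑ j ∈ I, lam j • y j = ∑ j ∈ J, mu j • y j ∧ AffineIndependent ℝ (fun j : J => y j) := by
  classical
  have hmem : ∑ j ∈ I, lam j • y j ∈ convexHull ℝ (y '' I) :=
    (convex_convexHull ℝ _).sum_mem (fun j hj => (hpos j hj).le) hsum
      fun j hj => subset_convexHull ℝ _ ⟨j, hj, rfl⟩
  obtain ⟨ι, _, z, w, hz, hind, hw, hw1, hwx⟩ := eq_pos_convex_span_of_mem_convexHull hmem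
  -- Several indices may carry the same point, so one index is chosen per point; affine independence
  -- makes the choice injective.
  choose g hgI hg using fun k => hz ⟨k, rfl⟩
  have hginj : Function.Injective g := fun a b hab =>
    hind.injective (by rw [← hg, ← hg, hab])
  have hmu : ∀ k, Function.extend g w 0 (g k) = w k := fun k => hginj.extend_apply _ _ _
  refine ⟨univ.image g, ?_, Function.extend g w 0, ?_, ?_, ?_, ?_⟩
  · intro j hj
    obtain ⟨k, _, rfl⟩ := mem_image.1 hj
    exact hgI k
  · intro j hj
    obtain ⟨k, _, rfl⟩ := mem_image.1 hj
    rw [hmu]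
    exact hw k
  · rw [sum_image hginj.injOn]
    simpa only [hmu] using hw1
  · rw [sum_image hginj.injOn]
    simp only [hmu, hg, hwx]
  · let e : ι ≃ (univ.image g : Finset ℕ) :=
      Equiv.ofBijective (fun k => ⟨g k, mem_image_of_mem _ (mem_univ k)⟩)
        ⟨fun a b hab => hginj (Subtype.ext_iff.1 hab), fun ⟨j, hj⟩ => by
          obtain ⟨k, _, rfl⟩ := mem_image.1 hj
          exact ⟨k, rfl⟩⟩
    rw [← affineIndependent_equiv e]
    have hz : (fun j : (univ.image g : Finset ℕ) => y j) ∘ e = z := funext hg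
    rwa [hz]

/-! ### Convex combinations of greedy bases. -/

/-- `x` is the convex combination, with positive coefficients `lam j`, of the extreme bases `y j`
generated by the orderings `L j`, for `j ∈ I`. -/
structure IsBaseCombination (f : Finset V → ℤ) (x : V → ℝ) (I : Finset ℕ) (L : ℕ → Ordering V)
    (y : ℕ → V → ℝ) (lam : ℕ → ℝ) : Prop where
  base : ∀ j ∈ I, y j = greedyBase f (L j)
  pos : ∀ j ∈ I, 0 < lam j
  sum : ∑ j ∈ I, lam j = 1
  eq : x = ∑ j ∈ I, lam j • y j

namespace IsBaseCombination

variable {f : Finset V → ℤ} {x : V → ℝ} {I : Finset ℕ} {L : ℕ → Ordering V} {y : ℕ → V → ℝ}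
  {lam : ℕ → ℝ}

theorem sum_eq (h : IsBaseCombination f x I L y lam) (X : Finset V) :
    ∑ v ∈ X, x v = ∑ j ∈ I, lam j * ∑ v ∈ X, y j v := by
  simp only [h.eq, Finset.sum_apply, Pi.smul_apply, smul_eq_mul]
  rw [Finset.sum_comm]
  simp only [Finset.mul_sum]

theorem sum_le (h : IsBaseCombination f x I L y lam) (hf : Submodular f) (hf0 : f ∅ = 0)
    (X : Finset V) : ∑ v ∈ X, x v ≤ (f X : ℝ) := by
  rw [h.sum_eq]
  calc ∑ j ∈ I, lam j * ∑ v ∈ X, y j v ≤ ∑ j ∈ I, lam j * (f X : ℝ) := by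
        refine Finset.sum_le_sum fun j hj => mul_le_mul_of_nonneg_left ?_ (h.pos j hj).le
        rw [h.base j hj]
        exact greedyBase_sum_le hf hf0 _ X
    _ = f X := by rw [← Finset.sum_mul, h.sum, one_mul]

theorem sum_eq_of_tight (h : IsBaseCombination f x I L y lam) {X : Finset V}
    (hX : ∀ j ∈ I, ∑ v ∈ X, greedyBase f (L j) v = (f X : ℝ)) : ∑ v ∈ X, x v = (f X : ℝ) := by
  rw [h.sum_eq]
  calc ∑ j ∈ I, lam j * ∑ v ∈ X, y j v = ∑ j ∈ I, lam j * (f X : ℝ) := by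
        refine Finset.sum_congr rfl fun j hj => ?_
        rw [h.base j hj, hX j hj]
    _ = f X := by rw [← Finset.sum_mul, h.sum, one_mul]

variable {i : ℕ} {u v : V} {c : ℝ}

/-- Covers nonsaturating pushes as well, once `split` has cut the coefficient down to α / c. -/
theorem saturating (h : IsBaseCombination f x I L y lam) (hf : Submodular f) (hf0 : f ∅ = 0)
    (hi : i ∈ I) (hu : (L i u : ℕ) = (L i v : ℕ) + 1) (hc : IsExchangeCapacity f (y i) u v c) :
    IsBaseCombination f (x + (lam i * c) • (Pi.single u 1 - Pi.single v 1 : V → ℝ)) I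
      (Function.update L i ((Equiv.swap u v).trans (L i)))
      (Function.update y i (y i + c • (Pi.single u 1 - Pi.single v 1))) lam where
  base j hj := by
    by_cases hji : j = i
    · subst hji
      rw [Function.update_self, Function.update_self]
      rw [h.base j hj] at hc ⊢
      exact hc.greedyBase_add hf hf0 hu
    · rw [Function.update_of_ne hji, Function.update_of_ne hji, h.base j hj]
  pos := h.pos
  sum := h.sum
  eq := by
    have h1 : ∀ j ∈ I.erase i, lam j •
        Function.update y i (y i + c • (Pi.single u 1 - Pi.single v 1 : V → ℝ)) j =
        lam j • y j := fun j hj => by rw [Function.update_of_ne (ne_of_mem_erase hj)]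
    rw [h.eq, ← Finset.add_sum_erase I _ hi, ← Finset.add_sum_erase I _ hi,
      Finset.sum_congr rfl h1, Function.update_self, smul_add, smul_smul]
    abel

/-- Splitting one term of a convex combination into two. -/
theorem split (h : IsBaseCombination f x I L y lam) (hi : i ∈ I) {k : ℕ} (hk : k ∉ I) {β : ℝ}
    (h0 : 0 < β) (h1 : β < lam i) :
    IsBaseCombination f x (insert k I) (Function.update L k (L i)) (Function.update y k (y i))
      (Function.update (Function.update lam k (lam i - β)) i β) := by
  have hki : k ≠ i := fun e => hk (e ▸ hi)
  have hk' : ∀ j ∈ I, j ≠ k := fun j hj e => hk (e ▸ hj)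
  have hlam : ∀ j ∈ I.erase i,
      Function.update (Function.update lam k (lam i - β)) i β j = lam j := fun j hj => by
    rw [Function.update_of_ne (ne_of_mem_erase hj),
      Function.update_of_ne (hk' j (mem_of_mem_erase hj))]
  have hlamk : Function.update (Function.update lam k (lam i - β)) i β k = lam i - β := by
    rw [Function.update_of_ne hki, Function.update_self]
  refine ⟨fun j hj => ?_, fun j hj => ?_, ?_, ?_⟩
  · rcases mem_insert.1 hj with rfl | hj
    · rw [Function.update_self, Function.update_self, h.base i hi]
    · rw [Function.update_of_ne (hk' j hj), Function.update_of_ne (hk' j hj), h.base j hj]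
  · rcases mem_insert.1 hj with rfl | hj
    · rw [hlamk]; linarith
    · by_cases hji : j = i
      · subst hji; rwa [Function.update_self]
      · rw [hlam j (mem_erase.2 ⟨hji, hj⟩)]
        exact h.pos j hj
  · rw [Finset.sum_insert hk, ← Finset.add_sum_erase I _ hi, Finset.sum_congr rfl hlam, hlamk,
      Function.update_self, ← h.sum, ← Finset.add_sum_erase I _ hi]
    ring
  · have hy : ∀ j ∈ I.erase i, Function.update (Function.update lam k (lam i - β)) i β j •
        Function.update y k (y i) j = lam j • y j := fun j hj => by
      rw [hlam j hj, Function.update_of_ne (hk' j (mem_of_mem_erase hj))]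
    rw [Finset.sum_insert hk, ← Finset.add_sum_erase I _ hi, Finset.sum_congr rfl hy, hlamk,
      Function.update_self, Function.update_self, Function.update_of_ne hki.symm, h.eq,
      ← Finset.add_sum_erase I _ hi, ← add_assoc, ← add_smul]
    congr 2
    ring

end IsBaseCombination

/-! ### Excess, reachability and the invariant. -/

namespace State

/-- The excess `x - ∂φ` that the augmentations have to cancel. -/
noncomputable def excess (s : State V) (v : V) : ℝ := s.x v - boundary s.φ v

omit [DecidableEq V] in
theorem mem_S {s : State V} {v : V} : v ∈ s.S ↔ s.excess v ≤ -s.δ := by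
  simp only [S, excess, mem_filter, mem_univ, true_and]
  constructor <;> intro h <;> linarith

omit [DecidableEq V] in
theorem mem_T {s : State V} {v : V} : v ∈ s.T ↔ s.δ ≤ s.excess v := by
  simp only [T, excess, mem_filter, mem_univ, true_and]
  constructor <;> intro h <;> linarith

omit [DecidableEq V] in
theorem mem_W {s : State V} {v : V} :
    v ∈ s.W ↔ ∃ a ∈ s.S, Relation.ReflTransGen (Residual s.φ) a v := by
  simp [W]

omit [DecidableEq V] in
theorem mem_W_of_residual {s : State V} {u v : V} (hu : u ∈ s.W) (h : Residual s.φ u v) :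
    v ∈ s.W := by
  obtain ⟨a, ha, hau⟩ := mem_W.1 hu
  exact mem_W.2 ⟨a, ha, hau.tail h⟩

omit [DecidableEq V] in
theorem S_subset_W (s : State V) : s.S ⊆ s.W := fun v hv => mem_W.2 ⟨v, hv, .refl⟩

-- A residual walk from S stays in W, so only arcs with tail in W have to survive.
omit [DecidableEq V] in
theorem W_subset_W {s t : State V} (hS : t.S = s.S)
    (h : ∀ p ∈ s.W, ∀ q, Residual s.φ p q → Residual t.φ p q) : s.W ⊆ t.W := by
  intro w hw
  obtain ⟨a, ha, haw⟩ := mem_W.1 hw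
  refine mem_W.2 ⟨a, hS ▸ ha, ?_⟩
  clear hw
  induction haw with
  | refl => exact .refl
  | tail hab hbc ih => exact ih.tail (h _ (mem_W.2 ⟨a, ha, hab⟩) _ hbc)

end State

theorem boundary_sendArc (φ : V → V → ℝ) (u v : V) (α : ℝ) (w : V) :
    boundary (sendArc φ u v α) w =
      boundary φ w - α * (Pi.single u 1 - Pi.single v 1 : V → ℝ) w := by
  have h1 : ∑ a, (if a = u ∧ w = v then α else 0) = if w = v then α else 0 := by
    by_cases h : w = v <;> simp [h]
  have h2 : ∑ a, (if a = v ∧ w = u then α else 0) = if w = u then α else 0 := by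
    by_cases h : w = u <;> simp [h]
  simp only [boundary, sendArc, Finset.sum_sub_distrib, Finset.sum_add_distrib, h1, h2,
    Pi.sub_apply, Pi.single_apply]
  split_ifs <;> ring

/-- The invariant of the algorithm. -/
structure Inv (f : Finset V → ℤ) (M : ℝ) (s : State V) : Prop where
  combination : IsBaseCombination f s.x s.I s.L s.y s.lam
  antisymm : ∀ u v, s.φ v u = -s.φ u v
  bound : ∀ u v, |s.φ u v| ≤ s.δ
  pos : s.stage ≠ .scaling → s.stage ≠ .done → 0 < s.δ
  -- Before the first phase nothing is known about the guard; δ = M records that case.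
  exit : s.stage = .scaling ∨ s.stage = .done → ¬ PhaseGuard s ∨ s.δ = M
  small : s.stage = .done → s.δ < 1 / (Fintype.card V : ℝ) ^ 2

theorem inv_initial [Nonempty V] (f : Finset V → ℤ) {M : ℝ} (hM : 0 ≤ M) (L : Ordering V)
    (i : ℕ) : Inv f M (initial f M L i) where
  combination := ⟨fun _ _ => rfl, fun _ _ => zero_lt_one, by simp [initial], by simp [initial]⟩
  antisymm := by simp [initial]
  bound := by simpa [initial] using hM
  pos h := (h rfl).elim
  exit _ := Or.inr rfl
  small h := by simp [initial] at h

/-! ### Pushes. -/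

section Push

variable {f : Finset V → ℤ} {M : ℝ} {s : State V} {i : ℕ} {u v : V} {c : ℝ} {k : ℕ}

theorem push_of_saturating (h : ¬ min s.δ (s.lam i * c) < s.lam i * c) :
    push s i u v c k =
      { s with
        φ := sendArc s.φ u v (-(min s.δ (s.lam i * c)))
        x := ∑ j ∈ s.I, s.lam j •
          Function.update s.y i (s.y i + c • (Pi.single u 1 - Pi.single v 1)) j
        L := Function.update s.L i ((Equiv.swap u v).trans (s.L i))
        y := Function.update s.y i (s.y i + c • (Pi.single u 1 - Pi.single v 1)) } := by
  simp only [push, if_neg h]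

theorem push_of_nonsaturating (h : min s.δ (s.lam i * c) < s.lam i * c) :
    push s i u v c k =
      { s with
        φ := sendArc s.φ u v (-(min s.δ (s.lam i * c)))
        x := ∑ j ∈ insert k s.I, Function.update (Function.update s.lam k
          (s.lam i - min s.δ (s.lam i * c) / c)) i (min s.δ (s.lam i * c) / c) j •
          Function.update (Function.update s.y k (s.y i)) i
            (s.y i + c • (Pi.single u 1 - Pi.single v 1)) j
        I := insert k s.I
        L := Function.update (Function.update s.L k (s.L i)) i ((Equiv.swap u v).trans (s.L i))
        y := Function.update (Function.update s.y k (s.y i)) i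
            (s.y i + c • (Pi.single u 1 - Pi.single v 1))
        lam := Function.update (Function.update s.lam k
          (s.lam i - min s.δ (s.lam i * c) / c)) i (min s.δ (s.lam i * c) / c) } := by
  simp only [push, if_pos h]

/-- Otherwise u is a later vertex outside W, and the vertex of W behind v also lies behind u, so v
was not the last candidate. -/
theorem mem_W_of_active (hZ : (i, v) ∈ s.Z) (hu : (s.L i u : ℕ) = (s.L i v : ℕ) + 1) :
    u ∈ s.W := by
  have hactive : IsActive (s.L i) s.W v := hZ.2
  obtain ⟨hv, ⟨w, hw⟩, hlast⟩ := hactive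
  by_contra hnu
  rw [mem_sdiff, Ordering.mem_upTo, Fin.le_def] at hw
  have := hlast u hnu ⟨w, by
    rw [mem_sdiff, Ordering.mem_upTo, Fin.le_def]
    refine ⟨hw.1, fun h => ?_⟩
    have h1 : (s.L i w : ℕ) = s.L i u := by
      have := hw.2
      omega
    have h2 : w = u := (s.L i).injective (Fin.ext h1)
    exact hnu (h2 ▸ hw.1)⟩
  rw [Fin.le_def] at this
  omega

theorem flow_pos_of_active (hZ : (i, v) ∈ s.Z) (hu : (s.L i u : ℕ) = (s.L i v : ℕ) + 1) :
    0 < s.φ u v := by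
  by_contra h
  refine hZ.2.1 (State.mem_W_of_residual (mem_W_of_active hZ hu) ⟨?_, not_lt.1 h⟩)
  rintro rfl
  omega

variable (hf : Submodular f) (hf0 : f ∅ = 0) (hs : Inv f M s)
  (hZ : (i, v) ∈ s.Z) (hu : (s.L i u : ℕ) = (s.L i v : ℕ) + 1)
  (hc : IsExchangeCapacity f (s.y i) u v c) (hk : k ∉ s.I)
include hf hf0 hs hZ hu hc hk

theorem isBaseCombination_push (hδ : 0 < s.δ) :
    IsBaseCombination f (s.x + min s.δ (s.lam i * c) • (Pi.single u 1 - Pi.single v 1 : V → ℝ))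
      (push s i u v c k).I (push s i u v c k).L (push s i u v c k).y (push s i u v c k).lam := by
  by_cases h : min s.δ (s.lam i * c) < s.lam i * c
  · rw [push_of_nonsaturating h]
    have hlam := hs.combination.pos i hZ.1
    have hα : min s.δ (s.lam i * c) = s.δ := by
      rcases min_choice s.δ (s.lam i * c) with e | e
      · exact e
      · rw [e] at h; exact (lt_irrefl _ h).elim
    rw [hα] at h ⊢
    -- Here 0 < δ < λ_i c, so the piece split off has weight δ / c and is then pushed saturatingly
    -- by (δ / c) c = δ.
    have hc0 : 0 < c := pos_of_mul_pos_right (hδ.trans h) hlam.le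
    have hsp := hs.combination.split hZ.1 hk (div_pos hδ hc0) ((div_lt_iff₀ hc0).2 h)
    have hki : k ≠ i := fun e => hk (e ▸ hZ.1)
    have := hsp.saturating hf hf0 (i := i) (u := u) (v := v) (c := c) (mem_insert_of_mem hZ.1)
      (by rwa [Function.update_of_ne hki.symm]) (by rwa [Function.update_of_ne hki.symm])
    rw [Function.update_self, div_mul_cancel₀ _ hc0.ne', Function.update_of_ne hki.symm,
      Function.update_of_ne hki.symm] at this
    exact this
  · rw [push_of_saturating h]
    have hα : min s.δ (s.lam i * c) = s.lam i * c :=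
      le_antisymm (min_le_right _ _) (not_lt.1 h)
    rw [hα]
    exact hs.combination.saturating hf hf0 hZ.1 hu hc

theorem push_x (hδ : 0 < s.δ) : (push s i u v c k).x =
    s.x + min s.δ (s.lam i * c) • (Pi.single u 1 - Pi.single v 1 : V → ℝ) :=
  (isBaseCombination_push hf hf0 hs hZ hu hc hk hδ).eq.symm

theorem excess_push (hδ : 0 < s.δ) : (push s i u v c k).excess = s.excess := by
  funext w
  rw [State.excess, push_x hf hf0 hs hZ hu hc hk hδ]
  change _ - boundary (sendArc s.φ u v _) w = s.x w - boundary s.φ w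
  rw [boundary_sendArc]
  simp only [Pi.add_apply, Pi.smul_apply, smul_eq_mul]
  ring

end Push

omit [Fintype V] in
theorem sendArc_antisymm {φ : V → V → ℝ} (h : ∀ a b, φ b a = -φ a b) (u v : V) (α : ℝ)
    (a b : V) : sendArc φ u v α b a = -sendArc φ u v α a b := by
  have e1 : (b = u ∧ a = v) ↔ (a = v ∧ b = u) := and_comm
  have e2 : (b = v ∧ a = u) ↔ (a = u ∧ b = v) := and_comm
  simp only [sendArc, e1, e2, h a b]
  ring

omit [Fintype V] in
theorem sendArc_self {φ : V → V → ℝ} {u v : V} (huv : u ≠ v) (α : ℝ) :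
    sendArc φ u v α u v = φ u v + α := by
  simp [sendArc, huv]

omit [Fintype V] in
theorem abs_sendArc_le {φ : V → V → ℝ} (h : ∀ a b, φ b a = -φ a b) {δ : ℝ}
    (hφ : ∀ a b, |φ a b| ≤ δ) {u v : V} (huv : u ≠ v) {α : ℝ} (hα : |φ u v + α| ≤ δ) (a b : V) :
    |sendArc φ u v α a b| ≤ δ := by
  by_cases h1 : a = u ∧ b = v
  · obtain ⟨rfl, rfl⟩ := h1
    rwa [sendArc_self huv]
  by_cases h2 : a = v ∧ b = u
  · obtain ⟨rfl, rfl⟩ := h2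
    rwa [sendArc_antisymm h, abs_neg, sendArc_self huv]
  · simpa [sendArc, h1, h2] using hφ a b

section Push

variable {f : Finset V → ℤ} {M : ℝ} {s : State V} {i : ℕ} {u v : V} {c : ℝ} {k : ℕ}
variable (hf : Submodular f) (hf0 : f ∅ = 0) (hs : Inv f M s)
  (hZ : (i, v) ∈ s.Z) (hu : (s.L i u : ℕ) = (s.L i v : ℕ) + 1)
  (hc : IsExchangeCapacity f (s.y i) u v c)
include hf hf0 hs hZ hc

theorem push_amount_nonneg (hδ : 0 < s.δ) : 0 ≤ min s.δ (s.lam i * c) := by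
  refine le_min hδ.le (mul_nonneg (hs.combination.pos i hZ.1).le (hc.nonneg ?_))
  rw [hs.combination.base i hZ.1]
  exact greedyBase_mem hf hf0 _

variable (hk : k ∉ s.I)
include hu hk

theorem inv_push (hst : s.stage = .pushing) : Inv f M (push s i u v c k) := by
  have hδ : 0 < s.δ := hs.pos (by simp [hst]) (by simp [hst])
  have huv : u ≠ v := by rintro rfl; omega
  refine ⟨?_, sendArc_antisymm hs.antisymm u v _, ?_, fun _ _ => hδ, ?_, ?_⟩
  · rw [push_x hf hf0 hs hZ hu hc hk hδ]
    exact isBaseCombination_push hf hf0 hs hZ hu hc hk hδ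
  · refine abs_sendArc_le hs.antisymm hs.bound huv ?_
    have h1 := flow_pos_of_active hZ hu
    have h2 := (abs_le.1 (hs.bound u v)).2
    have h3 := push_amount_nonneg hf hf0 hs hZ hc hδ
    have h4 : min s.δ (s.lam i * c) ≤ s.δ := min_le_left _ _
    rw [abs_le]
    constructor <;> linarith
  · intro h
    change s.stage = _ ∨ s.stage = _ at h
    simp [hst] at h
  · intro h
    change s.stage = _ at h
    simp [hst] at h

theorem push_S (hδ : 0 < s.δ) : (push s i u v c k).S = s.S := by
  ext w
  rw [State.mem_S, State.mem_S, excess_push hf hf0 hs hZ hu hc hk hδ]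
  rfl

/-- The only residual arc that can be lost is (v, u), and its tail lies outside W. -/
theorem subset_push_W (hδ : 0 < s.δ) : s.W ⊆ (push s i u v c k).W := by
  refine State.W_subset_W (push_S hf hf0 hs hZ hu hc hk hδ) fun p hp q hpq => ⟨hpq.1, ?_⟩
  have hpv : p ≠ v := fun h => hZ.2.1 (h ▸ hp)
  have h3 := push_amount_nonneg hf hf0 hs hZ hc hδ
  have h4 := hpq.2
  change sendArc s.φ u v _ p q ≤ 0
  simp only [sendArc, hpv, false_and, if_false]
  split_ifs <;> linarith

/-- The amount is the full δ ≥ φ(u, v), so (u, v) becomes residual, and u is in W. -/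
theorem mem_push_W_of_nonsaturating (hδ : 0 < s.δ)
    (h : min s.δ (s.lam i * c) < s.lam i * c) : v ∈ (push s i u v c k).W := by
  have huv : u ≠ v := by rintro rfl; omega
  refine State.mem_W_of_residual
    (subset_push_W hf hf0 hs hZ hu hc hk hδ (mem_W_of_active hZ hu)) ⟨huv, ?_⟩
  have hα : min s.δ (s.lam i * c) = s.δ := by
    rcases min_choice s.δ (s.lam i * c) with e | e
    · exact e
    · rw [e] at h; exact (lt_irrefl _ h).elim
  change sendArc s.φ u v _ u v ≤ 0
  rw [sendArc_self huv, hα]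
  have := (abs_le.1 (hs.bound u v)).2
  linarith

end Push

/-- Within W only u moves, one place forward. -/
theorem sum_swap_lt {L : Ordering V} {W : Finset V} {u v : V} (hu : (L u : ℕ) = (L v : ℕ) + 1)
    (huW : u ∈ W) (hvW : v ∉ W) :
    ∑ w ∈ W, (((Equiv.swap u v).trans L) w : ℕ) < ∑ w ∈ W, (L w : ℕ) := by
  refine Finset.sum_lt_sum (fun w hw => ?_) ⟨u, huW, ?_⟩
  · have hwv : w ≠ v := fun h => hvW (h ▸ hw)
    rw [Equiv.trans_apply, Equiv.swap_apply_def]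
    split_ifs with h
    · subst h; omega
    · rfl
  · rw [Equiv.trans_apply, Equiv.swap_apply_left]
    omega

/-! ### Augmentations. -/

section Augment

variable {f : Finset V → ℤ} {M : ℝ} {s : State V} {P : List V}

theorem excess_augment (hP : P.Nodup) (v : V) : (augment s P).excess v =
    s.excess v - s.δ *
      ((if P.getLast? = some v then 1 else 0) - (if P.head? = some v then 1 else 0)) := by
  have : boundary (augment s P).φ v = boundary s.φ v + s.δ *
      ((if P.getLast? = some v then 1 else 0) - (if P.head? = some v then 1 else 0)) := by
    rw [← sum_zip_tail_sub P hP v, Finset.mul_sum]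
    simp only [boundary, ← Finset.sum_add_distrib]
    refine Finset.sum_congr rfl fun u _ => ?_
    simp only [augment]
    split_ifs <;> ring
  rw [State.excess, State.excess, this]
  change s.x v - _ = _
  ring

theorem inv_augment (hs : Inv f M s) (hst : s.stage = .pushing) (hP : IsAugmentingPath s P) :
    Inv f M (augment s P) := by
  have hδ : 0 < s.δ := hs.pos (by simp [hst]) (by simp [hst])
  refine ⟨hs.combination, fun a b => ?_, fun a b => ?_, fun _ _ => hδ, ?_, ?_⟩
  · simp only [augment, hs.antisymm a b]
    ring
  · have hres : ∀ {a b}, (a, b) ∈ P.zip P.tail → s.φ a b ≤ 0 := fun h =>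
      (rel_of_mem_zip_tail hP.2.1 h).2
    have h1 := abs_le.1 (hs.bound a b)
    have h2 := hs.antisymm a b
    simp only [augment]
    rw [abs_le]
    split_ifs with p q q
    · constructor <;> linarith
    · have := hres p
      constructor <;> linarith
    · have := hres q
      constructor <;> linarith
    · constructor <;> linarith
  · intro h; simp [augment] at h
  · intro h; simp [augment] at h

/-- An augmentation decreases the total excess. -/
theorem sum_abs_excess_augment_le (hδ : 0 < s.δ) (hP : IsAugmentingPath s P) :
    ∑ v, |(augment s P).excess v| ≤ ∑ v, |s.excess v| - s.δ := by
  obtain ⟨hnd, -, ⟨a, haS, ha⟩, ⟨b, hbT, hb⟩⟩ := hP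
  rw [State.mem_S] at haS
  rw [State.mem_T] at hbT
  -- The ends differ since δ > 0. The equal gain at b is not needed.
  have key : ∀ v, |(augment s P).excess v| ≤ |s.excess v| - if v = a then s.δ else 0 := by
    intro v
    rw [excess_augment hnd, ha, hb]
    simp only [Option.some.injEq]
    by_cases hva : v = a
    · have hvb : b ≠ v := by rintro rfl; rw [hva] at hbT; linarith
      subst hva
      simp only [hvb, if_true, if_false]
      rw [abs_of_nonpos (by linarith : s.excess v ≤ 0), abs_of_nonpos (by linarith)]
      linarith
    · by_cases hvb : v = b
      · subst hvb
        simp only [hva, Ne.symm hva, if_true, if_false]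
        rw [abs_of_nonneg (by linarith : 0 ≤ s.excess v), abs_of_nonneg (by linarith)]
        linarith
      · simp [hva, Ne.symm hva, Ne.symm hvb]
  calc ∑ v, |(augment s P).excess v| ≤ ∑ v, (|s.excess v| - if v = a then s.δ else 0) :=
        Finset.sum_le_sum fun v _ => key v
    _ = _ := by simp [Finset.sum_sub_distrib]

end Augment

/-! ### Preservation of the invariant. -/

theorem inv_beginPhase [Nonempty V] {f : Finset V → ℤ} {M : ℝ} {s : State V} (hs : Inv f M s)
    (hδ : 1 / (Fintype.card V : ℝ) ^ 2 ≤ s.δ) : Inv f M (beginPhase s) := by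
  have hpos : 0 < s.δ := lt_of_lt_of_le (by positivity) hδ
  refine ⟨hs.combination, fun a b => ?_, fun a b => ?_, fun _ _ => half_pos hpos, ?_, ?_⟩
  · simp only [beginPhase, hs.antisymm a b]
    rcases le_total (s.δ / 2) (s.φ a b) with h | h <;>
      rcases le_total (-(s.δ / 2)) (s.φ a b) with h' | h' <;>
      simp only [min_def, max_def] <;> split_ifs <;> linarith
  · simp only [beginPhase]
    rw [abs_le]
    exact ⟨le_max_left _ _, max_le (by linarith) (min_le_left _ _)⟩
  · intro h; simp [beginPhase] at h
  · intro h; simp [beginPhase] at h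

theorem Inv.step [Nonempty V] {f : Finset V → ℤ} (hf : Submodular f) (hf0 : f ∅ = 0) {M : ℝ}
    {s t : State V} (hs : Inv f M s) (h : Step f s t) : Inv f M t := by
  cases h with
  | beginPhase hst hδ => exact inv_beginPhase hs hδ
  | halt hst hδ =>
    exact ⟨hs.combination, hs.antisymm, hs.bound, fun _ h => (h rfl).elim,
      fun _ => hs.exit (Or.inl hst), fun _ => hδ⟩
  | enter hst hg =>
    exact ⟨hs.combination, hs.antisymm, hs.bound, fun _ _ => hs.pos (by simp [hst]) (by simp [hst]),
      by simp, by simp⟩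
  | endPhase hst hg =>
    exact ⟨hs.combination, hs.antisymm, hs.bound, fun h => (h rfl).elim,
      fun _ => Or.inl hg, by simp⟩
  | push hst hW i u v hZ hu c hc k hk => exact inv_push hf hf0 hs hZ hu hc hk hst
  | augment hst hW P hP => exact inv_augment hs hst hP
  | noPath hst hW hZ =>
    exact ⟨hs.combination, hs.antisymm, hs.bound, fun _ _ => hs.pos (by simp [hst]) (by simp [hst]),
      by simp, by simp⟩
  | reduce hst J hJ mu hpos hsum hx hind =>
    exact ⟨⟨fun j hj => hs.combination.base j (hJ hj), hpos, hsum, hx⟩, hs.antisymm, hs.bound,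
      fun _ _ => hs.pos (by simp [hst]) (by simp [hst]), by simp, by simp⟩

/-! ### Termination. -/

namespace State

/-- An upper bound for the number of augmentations in the rest of the phase, shifted so that it
decreases when the phase ends. -/
noncomputable def phaseRank (s : State V) : ℕ :=
  match s.stage with
  | .done => 0
  | .scaling => 1
  | _ => 2 + ⌊(∑ v, |s.excess v|) / s.δ⌋₊

open Classical in
/-- The position in the body of the phase loop. -/
noncomputable def stageRank (s : State V) : ℕ :=
  match s.stage with
  | .phase => if PhaseGuard s then 4 else 1
  | .pushing => 3
  -- Without a path or an active pair the guard fails, and 2 < 3. After an augmentation it may hold;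
  -- 5 is then harmless, as `phaseRank` has dropped.
  | .reducing => if PhaseGuard s then 5 else 2
  | _ => 0

/-- A quantity that decreases lexicographically with every step. -/
noncomputable def rank (s : State V) : ℕ ×ₗ ℕ ×ₗ ℕ ×ₗ ℕ ×ₗ ℕ :=
  toLex (⌊s.δ * (Fintype.card V : ℝ) ^ 2⌋₊, toLex (s.phaseRank, toLex (s.stageRank,
    toLex (Fintype.card V - #s.W, ∑ j ∈ s.I, ∑ w ∈ s.W, (s.L j w : ℕ)))))

end State

theorem Step.rank_lt [Nonempty V] {f : Finset V → ℤ} (hf : Submodular f) (hf0 : f ∅ = 0) {M : ℝ}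
    {s t : State V} (hs : Inv f M s) (h : Step f s t) : t.rank < s.rank := by
  simp only [State.rank, Prod.Lex.toLex_lt_toLex]
  cases h with
  | beginPhase hst hδ =>
    left
    have hn : (0 : ℝ) < (Fintype.card V : ℝ) ^ 2 := by positivity
    rw [div_le_iff₀ hn] at hδ
    have h1 : 1 ≤ ⌊s.δ * (Fintype.card V : ℝ) ^ 2⌋₊ := (Nat.one_le_floor_iff _).2 hδ
    have h2 : s.δ / 2 * (Fintype.card V : ℝ) ^ 2 = s.δ * (Fintype.card V : ℝ) ^ 2 / (2 : ℕ) := by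
      push_cast; ring
    change ⌊s.δ / 2 * (Fintype.card V : ℝ) ^ 2⌋₊ < _
    rw [h2, Nat.floor_div_natCast]
    omega
  | halt hst hδ =>
    refine Or.inr ⟨rfl, Or.inl ?_⟩
    simp [State.phaseRank, hst]
  | enter hst hg =>
    refine Or.inr ⟨rfl, Or.inr ⟨?_, Or.inl ?_⟩⟩
    · simp only [State.phaseRank, hst]; rfl
    · simp [State.stageRank, hst, hg]
  | endPhase hst hg =>
    refine Or.inr ⟨rfl, Or.inl ?_⟩
    simp only [State.phaseRank, hst]
    omega
  | push hst hW i u v hZ hu c hc k hk =>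
    have hδ : 0 < s.δ := hs.pos (by simp [hst]) (by simp [hst])
    have hsub := subset_push_W hf hf0 hs hZ hu hc hk hδ
    refine Or.inr ⟨rfl, Or.inr ⟨?_, Or.inr ⟨?_, ?_⟩⟩⟩
    · have hst' : (SFM.push s i u v c k).stage = .pushing := hst
      simp only [State.phaseRank, hst, hst', excess_push hf hf0 hs hZ hu hc hk hδ]
      rfl
    · have hst' : (SFM.push s i u v c k).stage = .pushing := hst
      simp only [State.stageRank, hst, hst']
    · rcases hsub.eq_or_ssubset with heq | hlt
      · right
        rw [← heq]
        refine ⟨rfl, ?_⟩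
        -- A nonsaturating push would have brought v into W. Hence no index is added, and only L_i
        -- changes.
        have hsat : ¬ min s.δ (s.lam i * c) < s.lam i * c := fun h =>
          hZ.2.1 (heq ▸ mem_push_W_of_nonsaturating hf hf0 hs hZ hu hc hk hδ h)
        rw [push_of_saturating hsat]
        have hlt := sum_swap_lt hu (mem_W_of_active hZ hu) hZ.2.1
        refine Finset.sum_lt_sum (fun j _ => ?_) ⟨i, hZ.1, ?_⟩
        · by_cases hj : j = i
          · subst hj
            simp only [Function.update_self]
            exact hlt.le
          · simp only [Function.update_of_ne hj]
            exact le_rfl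
        · simp only [Function.update_self]
          exact hlt
      · left
        have h1 := Finset.card_lt_card hlt
        have h2 := Finset.card_le_univ (SFM.push s i u v c k).W
        omega
  | augment hst hW P hP =>
    have hδ : 0 < s.δ := hs.pos (by simp [hst]) (by simp [hst])
    refine Or.inr ⟨rfl, Or.inl ?_⟩
    have h1 := sum_abs_excess_augment_le hδ hP
    have h2 : 0 ≤ (∑ v, |(SFM.augment s P).excess v|) / s.δ := by positivity
    have h3 : (∑ v, |(SFM.augment s P).excess v|) / s.δ + 1 ≤ (∑ v, |s.excess v|) / s.δ := by
      rw [← div_self hδ.ne', ← add_div]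
      exact div_le_div_of_nonneg_right (by linarith) hδ.le
    have h4 := Nat.floor_mono h3
    rw [Nat.floor_add_one h2] at h4
    have hst' : (SFM.augment s P).stage = .reducing := rfl
    have hδ' : (SFM.augment s P).δ = s.δ := rfl
    simp only [State.phaseRank, hst, hst', hδ']
    omega
  | noPath hst hW hZ =>
    refine Or.inr ⟨rfl, Or.inr ⟨?_, Or.inl ?_⟩⟩
    · simp only [State.phaseRank, hst]; rfl
    · have hg : ¬ PhaseGuard { s with stage := .reducing } := by
        rintro ⟨-, -, h | h⟩
        · exact h.ne_empty hW
        · exact h.ne_empty hZ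
      simp [State.stageRank, hst, hg]
  | reduce hst J hJ mu hpos hsum hx hind =>
    refine Or.inr ⟨rfl, Or.inr ⟨?_, Or.inl ?_⟩⟩
    · simp only [State.phaseRank, hst]; rfl
    -- S, T and W do not depend on I, and dropping indices only removes active pairs: the guard may
    -- become false but never true.
    · have hg : PhaseGuard { s with stage := .phase, I := J, lam := mu } → PhaseGuard s := by
        rintro ⟨h1, h2, h⟩
        exact ⟨h1, h2, h.imp id fun ⟨p, hp⟩ => ⟨p, hJ hp.1, hp.2⟩⟩
      simp only [State.stageRank, hst]
      split_ifs with h1 h2 h2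
      · omega
      · exact (h2 (hg h1)).elim
      · omega
      · omega

/-! ### Progress. -/

theorem exists_augmentingPath {s : State V} (h : (s.W ∩ s.T).Nonempty) :
    ∃ P, IsAugmentingPath s P := by
  obtain ⟨b, hb⟩ := h
  rw [mem_inter, State.mem_W] at hb
  obtain ⟨⟨a, ha, hab⟩, hbT⟩ := hb
  obtain ⟨P, h1, h2, h3, h4⟩ := exists_nodup_isChain_of_reflTransGen hab
  exact ⟨P, h1, h2, ⟨a, ha, h3⟩, ⟨b, hbT, h4⟩⟩

/-- The algorithm gets stuck only when it has terminated. -/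
theorem Inv.exists_step {f : Finset V → ℤ} (hf : Submodular f) (hf0 : f ∅ = 0) {M : ℝ}
    {s : State V} (hs : Inv f M s) (hst : s.stage ≠ .done) : ∃ t, Step f s t := by
  cases h : s.stage with
  | done => exact (hst h).elim
  | scaling =>
    rcases le_or_gt (1 / (Fintype.card V : ℝ) ^ 2) s.δ with hδ | hδ
    exacts [⟨_, .beginPhase s h hδ⟩, ⟨_, .halt s h hδ⟩]
  | phase =>
    by_cases hg : PhaseGuard s
    exacts [⟨_, .enter s h hg⟩, ⟨_, .endPhase s h hg⟩]
  | pushing =>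
    rcases (s.W ∩ s.T).eq_empty_or_nonempty with hW | hW
    · rcases s.Z.eq_empty_or_nonempty with hZ | ⟨⟨i, v⟩, hZ⟩
      · exact ⟨_, .noPath s h hW hZ⟩
      · obtain ⟨w, hw⟩ := hZ.2.2.1
        -- Some vertex of W lies behind v, so v has an immediate successor.
        have hlt : (s.L i v : ℕ) + 1 < Fintype.card V := by
          rw [mem_sdiff, Ordering.mem_upTo, not_le, Fin.lt_def] at hw
          have h1 : (s.L i v : ℕ) < s.L i w := hw.2
          have h2 := (s.L i w).isLt
          omega
        obtain ⟨u, hu⟩ := (s.L i).surjective ⟨(s.L i v : ℕ) + 1, hlt⟩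
        have hu' : (s.L i u : ℕ) = (s.L i v : ℕ) + 1 := by rw [hu]
        obtain ⟨k, hk⟩ := Infinite.exists_notMem_finset s.I
        have hc := isExchangeCapacity_greedyBase hf hf0 hu'
        rw [← hs.combination.base i hZ.1] at hc
        exact ⟨_, .push s h hW i u v hZ hu' _ hc k hk⟩
    · obtain ⟨P, hP⟩ := exists_augmentingPath hW
      exact ⟨_, .augment s h hW P hP⟩
  | reducing =>
    obtain ⟨J, hJ, mu, h1, h2, h3, h4⟩ := exists_affineIndependent_subset s.I s.y s.lam
      hs.combination.pos hs.combination.sum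
    exact ⟨_, .reduce s h J hJ mu h1 h2 (hs.combination.eq.trans h3) h4⟩

/-! ### Correctness of the output. -/

/-- If `W` has no active vertex, then it is an initial segment. -/
theorem mem_of_le_of_not_isActive {L : Ordering V} {W : Finset V} (h : ∀ v, ¬ IsActive L W v)
    {v w : V} (hv : v ∈ W) (hwv : L w ≤ L v) : w ∈ W := by
  classical
  by_contra hw
  have hne : (univ.filter fun a => a ∉ W ∧ (W \ Ordering.upTo L a).Nonempty).Nonempty := by
    refine ⟨w, ?_⟩
    rw [mem_filter]
    refine ⟨mem_univ _, hw, v, ?_⟩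
    rw [mem_sdiff, Ordering.mem_upTo]
    refine ⟨hv, fun h => hw ?_⟩
    rwa [L.injective (le_antisymm hwv h)]
  obtain ⟨a, ha, hmax⟩ := Finset.exists_max_image _ L hne
  rw [mem_filter] at ha
  exact h a ⟨ha.2.1, ha.2.2, fun b hb hb' => hmax b (mem_filter.2 ⟨mem_univ _, hb, hb'⟩)⟩

/-- Antisymmetry kills the diagonal term. The δ saved pays for the slack δ in S and T, for a total
of nδ. -/
theorem abs_boundary_le {f : Finset V → ℤ} {M : ℝ} {s : State V} (hs : Inv f M s) (v : V) :
    |boundary s.φ v| ≤ (Fintype.card V - 1) * s.δ := by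
  have h0 : s.φ v v = 0 := by linarith [hs.antisymm v v]
  rw [boundary, ← Finset.add_sum_erase _ _ (mem_univ v), h0, zero_add]
  refine (Finset.abs_sum_le_sum_abs _ _).trans ?_
  refine (Finset.sum_le_card_nsmul _ _ s.δ fun u _ => hs.bound u v).trans_eq ?_
  rw [Finset.card_erase_of_mem (mem_univ v), Finset.card_univ, nsmul_eq_mul,
    Nat.cast_sub (Fintype.card_pos_iff.2 ⟨v⟩), Nat.cast_one]

/-- At the end of a scaling phase with `δ < 1 / n ^ 2` the output is a minimizer. -/
theorem output_isMin [Nonempty V] {f : Finset V → ℤ} (hf : Submodular f) (hf0 : f ∅ = 0) {M : ℝ}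
    {s : State V} (hs : Inv f M s) (hg : ¬ PhaseGuard s)
    (hδ : s.δ < 1 / (Fintype.card V : ℝ) ^ 2) (Y : Finset V) : f s.output ≤ f Y := by
  have hn : (0 : ℝ) < (Fintype.card V : ℝ) ^ 2 := by positivity
  have hδ0 : 0 ≤ s.δ := (abs_nonneg _).trans 
    (hs.bound (Classical.arbitrary V) (Classical.arbitrary V))
  rw [lt_div_iff₀ hn] at hδ
  have hε : Fintype.card V * (Fintype.card V * s.δ) < 1 := by nlinarith
  have hle : ∀ v, v ∉ s.T → s.x v ≤ Fintype.card V * s.δ := fun v hv => by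
    rw [State.mem_T, State.excess] at hv
    have := (abs_le.1 (abs_boundary_le hs v)).2
    linarith
  have hge : ∀ v, v ∉ s.S → -(Fintype.card V * s.δ) ≤ s.x v := fun v hv => by
    rw [State.mem_S, State.excess] at hv
    have := (abs_le.1 (abs_boundary_le hs v)).1
    linarith
  have hε0 : 0 ≤ Fintype.card V * s.δ := by positivity
  refine isMin_of_tight (hs.combination.sum_le hf hf0) ?_ hε0 hε ?_ ?_ Y
  all_goals unfold State.output; split_ifs with hS hT
  · simp [hf0]
  · exact hs.combination.sum_eq_of_tight fun j _ =>
      greedyBase_sum_eq hf0 _ _ fun _ _ _ _ => mem_univ _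
  · refine hs.combination.sum_eq_of_tight fun j hj => greedyBase_sum_eq hf0 _ _ fun v hv w hw => ?_
    refine mem_of_le_of_not_isActive (fun a ha => hg ?_) hv hw
    exact ⟨nonempty_iff_ne_empty.2 hS, nonempty_iff_ne_empty.2 hT, Or.inr ⟨(j, a), hj, ha⟩⟩
  · simp
  · intro v _
    exact hle v (by simp [hT])
  · intro v hv
    refine hle v fun hvT => hg ?_
    exact ⟨nonempty_iff_ne_empty.2 hS, nonempty_iff_ne_empty.2 hT,
      Or.inl ⟨v, mem_inter.2 ⟨hv, hvT⟩⟩⟩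
  · intro v _
    exact hge v (by simp [hS])
  · intro v hv
    exact (hv (mem_univ v)).elim
  · intro v hv
    exact hge v fun h => hv (s.S_subset_W h)

omit [DecidableEq V] in
theorem eq_zero_of_lt [Nonempty V] {f : Finset V → ℤ} {M : ℝ} (hM : ∀ X, |(f X : ℝ)| ≤ M)
    (h : M < 1 / (Fintype.card V : ℝ) ^ 2) (X : Finset V) : f X = 0 := by
  have h1 : (1 : ℝ) ≤ Fintype.card V := by exact_mod_cast Fintype.card_pos
  have h2 : 1 / (Fintype.card V : ℝ) ^ 2 ≤ 1 := by
    rw [div_le_one (by positivity)]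
    exact one_le_pow₀ h1
  have h3 : |(f X : ℝ)| < 1 := (hM X).trans_lt (h.trans_le h2)
  exact Int.abs_lt_one_iff.1 (by exact_mod_cast h3)

end SFM

theorem mainTheorem1 {V : Type*} [Fintype V] [DecidableEq V] [Nonempty V]
    (f : Finset V → ℤ) (hf : SFM.Submodular f) (hf0 : f ∅ = 0)
    (M : ℝ) (hM : ∀ X : Finset V, |(f X : ℝ)| ≤ M)
    (L : SFM.Ordering V) (i : ℕ) :
    (¬ ∃ r : ℕ → SFM.State V, r 0 = SFM.initial f M L i ∧ ∀ m, SFM.Step f (r m) (r (m + 1))) ∧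
    ∀ s : SFM.State V, Relation.ReflTransGen (SFM.Step f) (SFM.initial f M L i) s →
      (∀ t, ¬ SFM.Step f s t) →
        s.stage = SFM.Stage.done ∧ s.δ < 1 / (Fintype.card V : ℝ) ^ 2 ∧
          ∀ Y : Finset V, f s.output ≤ f Y := by
  have hinit := SFM.inv_initial f ((abs_nonneg _).trans (hM ∅)) L i
  constructor
  · rintro ⟨r, h0, hr⟩
    have hinv : ∀ m, SFM.Inv f M (r m) := fun m => by
      induction m with
      | zero => rwa [h0]
      | succ m ih => exact ih.step hf hf0 (hr m)
    exact not_strictAnti_of_wellFoundedLT (fun m => (r m).rank)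
      (strictAnti_nat_of_succ_lt fun m => (hr m).rank_lt hf hf0 (hinv m))
  · intro s hreach hstuck
    have hs : SFM.Inv f M s := by
      clear hstuck
      induction hreach with
      | refl => exact hinit
      | tail _ h ih => exact ih.step hf hf0 h
    have hdone : s.stage = .done := by
      by_contra h
      obtain ⟨t, ht⟩ := hs.exists_step hf hf0 h
      exact hstuck t ht
    have hδ := hs.small hdone
    refine ⟨hdone, hδ, fun Y => ?_⟩
    rcases hs.exit (Or.inr hdone) with hg | hδM
    · exact SFM.output_isMin hf hf0 hs hg hδ Y
    -- If δ = M < 1/n² ≤ 1, integrality forces f = 0, and every set is a minimizer.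
    · have hz := SFM.eq_zero_of_lt hM (hδM ▸ hδ)
      rw [hz, hz]
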